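/- Consider the discrete-time linear system $x_{t+1}=Ax_t+Bu_t+w_t$, $t\ge 0$, with $A\in\mathbb R^{m\times m}$, $B\in\mathbb R^{m\times d}$, where $x_0\sim\mathcal N(0,X_0)$ and $w_t\sim\mathcal N(0,W)$, $t\ge 0$, are jointly independent Gaussian vectors in $\mathbb R^m$ with positive definite covariance matrices $X_0$ and $W$. Let $c(x,u)=x^\top Qx+u^\top Ru$ with $Q\in\mathbb R^{m\times m}$ and $R\in\mathbb R^{d\times d}$ symmetric positive definite, and let $\beta\neq 0$ be a real risk parameter. For a gain $K\in\mathbb R^{d\times m}$ let $(x_t)$ be the state process under the linear time-invariant state feedback $u_t=-Kx_t$, and define the risk-sensitive average cost $$\mathcal J(K)=\lim_{T\to\infty}\frac1T\,\frac2\beta\,\log\mathbb E\exp\Big[\frac\beta2\sum_{t=0}^{T-1}c(x_t,-Kx_t)\Big].$$ Suppose that the Riccati equation $$P_K=Q+K^\top RK+(A-BK)^\top\big[P_K-P_K\big(-\tfrac1\beta W^{-1}+P_K\big)^{-1}P_K\big](A-BK)$$ has a symmetric solution $P_K\ge 0$ such that (i) $P_K$ is stabilizing, that is, $\rho\big((A-BK)^\top(I-\beta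 P_KW)^{-1}\big)<1$, where $\rho$ denotes the spectral radius; (ii) $W^{-1}-\beta P_K>0$; and suppose that the initial covariance satisfies $X_0^{-1}-\beta P_K>0$ (equivalently, $\mathbb E\exp[\frac\beta2x_0^\top P_Kx_0]<\infty$; this is automatic if $\beta<0$). Then all the expectations in the definition of $\mathcal J(K)$ are finite, the limit exists, and $$\mathcal J(K)=-\frac1\beta\log\det(I-\beta P_KW).$$ -/

import Mathlib

open MeasureTheory ProbabilityTheory Filter Topology
open scoped Matrix

namespace LEQG

variable {m d : ℕ} {Ω : Type*}

/-- The one-stage cost `c(x, u) = xᵀ Q x + uᵀ R u`. -/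
def stageCost (Q : Matrix (Fin m) (Fin m) ℝ) (R : Matrix (Fin d) (Fin d) ℝ)
    (x : EuclideanSpace ℝ (Fin m)) (u : EuclideanSpace ℝ (Fin d)) : ℝ :=
  x.ofLp ⬝ᵥ Q *ᵥ x.ofLp + u.ofLp ⬝ᵥ R *ᵥ u.ofLp

/-- The linear time-invariant state feedback `u = -K x`. -/
def feedback (K : Matrix (Fin d) (Fin m) ℝ) (x : EuclideanSpace ℝ (Fin m)) :
    EuclideanSpace ℝ (Fin d) :=
  WithLp.toLp 2 (-(K *ᵥ x.ofLp))

/-- The state process `x_{t+1} = A x_t + B u_t + w_t` started at `x₀` and driven by the noise `w`,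
under the feedback `u_t = -K x_t`. -/
def state (A : Matrix (Fin m) (Fin m) ℝ) (B : Matrix (Fin m) (Fin d) ℝ)
    (K : Matrix (Fin d) (Fin m) ℝ) (x₀ : Ω → EuclideanSpace ℝ (Fin m))
    (w : ℕ → Ω → EuclideanSpace ℝ (Fin m)) : ℕ → Ω → EuclideanSpace ℝ (Fin m)
  | 0, ω => x₀ ω
  | t + 1, ω =>
      WithLp.toLp 2 (A *ᵥ (state A B K x₀ w t ω).ofLp
        + B *ᵥ (feedback K (state A B K x₀ w t ω)).ofLp) + w t ω

/-- The exponentiated `T`-stage cost `exp[(β/2) ∑_{t < T} c(x_t, -K x_t)]`. -/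
noncomputable def expCost (A : Matrix (Fin m) (Fin m) ℝ) (B : Matrix (Fin m) (Fin d) ℝ)
    (Q : Matrix (Fin m) (Fin m) ℝ) (R : Matrix (Fin d) (Fin d) ℝ) (β : ℝ)
    (K : Matrix (Fin d) (Fin m) ℝ) (x₀ : Ω → EuclideanSpace ℝ (Fin m))
    (w : ℕ → Ω → EuclideanSpace ℝ (Fin m)) (T : ℕ) (ω : Ω) : ℝ :=
  Real.exp (β / 2 * ∑ t ∈ Finset.range T,
    stageCost Q R (state A B K x₀ w t ω) (feedback K (state A B K x₀ w t ω)))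

/-- `x₀ ~ N(0, X₀)`, `w_t ~ N(0, W)` for every `t`, and `x₀, w_0, w_1, …` are jointly independent. -/
structure IsGaussianNoise [MeasurableSpace Ω] (μ : Measure Ω) (X₀ W : Matrix (Fin m) (Fin m) ℝ)
    (x₀ : Ω → EuclideanSpace ℝ (Fin m)) (w : ℕ → Ω → EuclideanSpace ℝ (Fin m)) : Prop where
  law_init : HasLaw x₀ (multivariateGaussian 0 X₀) μ
  law_noise : ∀ t, HasLaw (w t) (multivariateGaussian 0 W) μ
  indep : iIndepFun (fun k : Option ℕ => k.elim x₀ w) μ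

/-- `J` is the risk-sensitive average cost `lim_T (1/T) (2/β) log E exp[(β/2) ∑_{t<T} c(x_t, -K x_t)]`
of the gain `K`: all the expectations are finite and the limit exists and equals `J`. -/
def HasAverageCost [MeasurableSpace Ω] (μ : Measure Ω)
    (A : Matrix (Fin m) (Fin m) ℝ) (B : Matrix (Fin m) (Fin d) ℝ)
    (Q : Matrix (Fin m) (Fin m) ℝ) (R : Matrix (Fin d) (Fin d) ℝ) (β : ℝ)
    (K : Matrix (Fin d) (Fin m) ℝ) (x₀ : Ω → EuclideanSpace ℝ (Fin m))
    (w : ℕ → Ω → EuclideanSpace ℝ (Fin m)) (J : ℝ) : Prop :=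
  (∀ T : ℕ, Integrable (expCost A B Q R β K x₀ w T) μ) ∧
  Tendsto (fun T : ℕ => 1 / (T : ℝ) * (2 / β) * Real.log (∫ ω, expCost A B Q R β K x₀ w T ω ∂μ))
    atTop (𝓝 J)

/-- The algebraic Riccati equation
`P = Q + Kᵀ R K + (A - BK)ᵀ [P - P (-(1/β) W⁻¹ + P)⁻¹ P] (A - BK)`. -/
def Riccati (A : Matrix (Fin m) (Fin m) ℝ) (B : Matrix (Fin m) (Fin d) ℝ)
    (Q : Matrix (Fin m) (Fin m) ℝ) (R : Matrix (Fin d) (Fin d) ℝ) (W : Matrix (Fin m) (Fin m) ℝ)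
    (β : ℝ) (K : Matrix (Fin d) (Fin m) ℝ) (P : Matrix (Fin m) (Fin m) ℝ) : Prop :=
  P = Q + Kᵀ * R * K
    + (A - B * K)ᵀ * (P - P * ((-1 / β) • W⁻¹ + P)⁻¹ * P) * (A - B * K)

/-- `ρ(M) < 1`, where `ρ` is the largest modulus of the complex eigenvalues of `M`. -/
def SpectrallyStable (M : Matrix (Fin m) (Fin m) ℝ) : Prop :=
  spectralRadius ℂ (M.map (algebraMap ℝ ℂ)) < 1

end LEQG

/-! ### Algebra and monotonicity of the risk-adjusted Riccati iteration. -/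

namespace LEQG

variable {m d : ℕ}

/-! Write `F = A - BK`, `L = Q + KᵀRK`. Completing the square in a Gaussian integral
(`lintegral_exp_quadratic_multivariateGaussian`) shows that integrating out the last noise turns a
terminal cost `S` into `L + Fᵀ (riskAdjust W β S) F` one step earlier, at the price of a factor
`det(1 - βSW)^(-1/2)`. From zero terminal cost this yields the iterates `S_n = riccatiIter n`, and
`integrable_expCost_and_integral_eq` gives the expectation as the product of these factors for `S_0,
…, S_{T-1}` and one for `S_T` and `X₀`. Monotonicity gives `0 ≤ S_n ≤ P`, which keeps every factor
finite. If `S_n → P`, the logarithms of the noise factors converge, and so do their Cesàro means,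
while the single `X₀` term disappears after division by `T`.

The convergence (`tendsto_riccatiIter`) rests on `P - S_{n+1} = H (P - S_n) G_n` with `H = Fᵀ(1 -
βPW)⁻¹` stable and `G_n = (W⁻¹ - βS_n)⁻¹W⁻¹F`. For `β ≥ 0` the error is dominated by `Hⁿ P (Hⁿ)ᵀ`.
For `β ≤ 0` that comparison is not available; instead, `L > 0` and `S_n ≤ P` bound the products of
the `G_n`, and `Hⁿ → 0` does the rest. -/

/-- The risk-adjusted value matrix `S + β S (W⁻¹ - β S)⁻¹ S`. -/
noncomputable def riskAdjust (W : Matrix (Fin m) (Fin m) ℝ) (β : ℝ)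
    (S : Matrix (Fin m) (Fin m) ℝ) : Matrix (Fin m) (Fin m) ℝ :=
  S + β • (S * (W⁻¹ - β • S)⁻¹ * S)

/-- The finite-horizon Riccati iterates with zero terminal cost. -/
noncomputable def riccatiIter (L F W : Matrix (Fin m) (Fin m) ℝ) (β : ℝ) :
    ℕ → Matrix (Fin m) (Fin m) ℝ
  | 0 => 0
  | n + 1 => L + Fᵀ * riskAdjust W β (riccatiIter L F W β n) * F

/-- Push-through form of the risk adjustment, with `C` the inverse of `T - β S`. -/
lemma riskAdjust_identity {S T C : Matrix (Fin m) (Fin m) ℝ} {β : ℝ}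
    (h₁ : (T - β • S) * C = 1) (h₂ : C * (T - β • S) = 1) :
    S + β • (S * C * S) = T * C * S * C * T - β • (S * C * T * C * S) := by
  have e₁ : T * C = 1 + β • (S * C) := by
    rw [sub_mul, sub_eq_iff_eq_add, Matrix.smul_mul] at h₁; exact h₁
  have e₂ : C * T = 1 + β • (C * S) := by
    rw [mul_sub, sub_eq_iff_eq_add, Matrix.mul_smul] at h₂; exact h₂
  have e₃ : S * C * T * C * S = S * C * S + β • (S * C * S * C * S) := by
    rw [show S * C * T * C * S = S * C * (T * C) * S by simp only [mul_assoc], e₁]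
    simp only [mul_add, add_mul, mul_one, Matrix.mul_smul, Matrix.smul_mul, mul_assoc]
  rw [show T * C * S * C * T = T * C * S * (C * T) by simp only [mul_assoc], e₁, e₂, e₃]
  simp only [mul_add, add_mul, mul_one, one_mul, Matrix.mul_smul, Matrix.smul_mul, mul_assoc,
    smul_add, smul_smul]
  abel

lemma posSemidef_transpose_mul_mul_same {A : Matrix (Fin m) (Fin m) ℝ} (hA : A.PosSemidef)
    (B : Matrix (Fin m) (Fin d) ℝ) : (Bᵀ * A * B).PosSemidef := by
  simpa using hA.conjTranspose_mul_mul_same B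

lemma isSymm_of_posSemidef {A : Matrix (Fin m) (Fin m) ℝ} (hA : A.PosSemidef) : Aᵀ = A := by
  simpa [Matrix.IsHermitian] using hA.isHermitian

lemma mul_inv_of_posDef {A : Matrix (Fin m) (Fin m) ℝ} (hA : A.PosDef) : A * A⁻¹ = 1 :=
  Matrix.mul_nonsing_inv _ ((Matrix.isUnit_iff_isUnit_det _).1 hA.isUnit)

lemma inv_mul_of_posDef {A : Matrix (Fin m) (Fin m) ℝ} (hA : A.PosDef) : A⁻¹ * A = 1 :=
  Matrix.nonsing_inv_mul _ ((Matrix.isUnit_iff_isUnit_det _).1 hA.isUnit)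

lemma isSymm_inv_of_posDef {A : Matrix (Fin m) (Fin m) ℝ} (hA : A.PosDef) : (A⁻¹)ᵀ = A⁻¹ :=
  isSymm_of_posSemidef hA.inv.posSemidef

/-- For `β ≤ 0` the risk adjustment dominates the congruence of `S` by `(T - β S)⁻¹ T`. -/
lemma riskAdjust_sub_congr_posSemidef {S T : Matrix (Fin m) (Fin m) ℝ} {β : ℝ} (hβ : β ≤ 0)
    (hS : S.PosSemidef) (hT : T.PosDef) (hST : (T - β • S).PosDef) :
    (S + β • (S * (T - β • S)⁻¹ * S)
      - T * (T - β • S)⁻¹ * S * (T - β • S)⁻¹ * T).PosSemidef := by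
  rw [riskAdjust_identity (mul_inv_of_posDef hST) (inv_mul_of_posDef hST)]
  set C := (T - β • S)⁻¹ with hC
  have hCs : Cᵀ = C := isSymm_inv_of_posDef hST
  have := (posSemidef_transpose_mul_mul_same hT.posSemidef (C * S)).smul
    (neg_nonneg.2 hβ)
  rw [Matrix.transpose_mul, hCs, isSymm_of_posSemidef hS] at this
  convert this using 1
  simp only [mul_assoc, neg_smul]
  abel

/-- For `β ≥ 0` both summands are positive; for `β ≤ 0` the correction is negative, and positivity
comes from the congruence lower bound. -/
lemma riskAdjust_posSemidef {S T : Matrix (Fin m) (Fin m) ℝ} {β : ℝ}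
    (hS : S.PosSemidef) (hT : T.PosDef) (hST : (T - β • S).PosDef) :
    (S + β • (S * (T - β • S)⁻¹ * S)).PosSemidef := by
  have hCs := isSymm_inv_of_posDef hST
  rcases le_total 0 β with hβ | hβ
  · refine hS.add (Matrix.PosSemidef.smul ?_ hβ)
    have := posSemidef_transpose_mul_mul_same hST.inv.posSemidef S
    rwa [isSymm_of_posSemidef hS] at this
  · have h₁ := riskAdjust_sub_congr_posSemidef hβ hS hT hST
    have h₂ := posSemidef_transpose_mul_mul_same hS ((T - β • S)⁻¹ * T)
    rw [Matrix.transpose_mul, hCs, isSymm_of_posSemidef hT.posSemidef] at h₂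
    convert h₁.add h₂ using 1
    simp only [mul_assoc]
    abel

/-- A resolvent identity, based on `riskAdjust W β S = W⁻¹ (W⁻¹ - βS)⁻¹ S` and its mirror image for
`P`. The two outer inverses belong to different matrices, so errors factor exactly along the
iteration. -/
lemma riskAdjust_sub {S P W : Matrix (Fin m) (Fin m) ℝ} {β : ℝ} (hW : W.PosDef)
    (hS : (W⁻¹ - β • S).PosDef) (hP : (W⁻¹ - β • P).PosDef) :
    riskAdjust W β P - riskAdjust W β S
      = W⁻¹ * (W⁻¹ - β • S)⁻¹ * (P - S) * (W⁻¹ - β • P)⁻¹ * W⁻¹ := by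
  unfold riskAdjust
  have h₁ := mul_inv_of_posDef hS
  have h₂ := inv_mul_of_posDef hP
  have h₃ := inv_mul_of_posDef hS
  have h₄ := mul_inv_of_posDef hP
  have w₁ := mul_inv_of_posDef hW
  have w₂ := inv_mul_of_posDef hW
  have hX : P - S = (W⁻¹ - β • S) * W * P - S * W * (W⁻¹ - β • P) := by
    simp only [sub_mul, mul_sub, w₂, mul_assoc, w₁, Matrix.smul_mul, Matrix.mul_smul, one_mul,
      mul_one]
    abel
  set C := (W⁻¹ - β • S)⁻¹
  set E := (W⁻¹ - β • P)⁻¹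
  have e₁ : W⁻¹ * C = 1 + β • (S * C) := by
    rw [sub_mul, sub_eq_iff_eq_add, Matrix.smul_mul] at h₁; exact h₁
  have e₂ : E * W⁻¹ = 1 + β • (E * P) := by
    rw [mul_sub, sub_eq_iff_eq_add, Matrix.mul_smul] at h₂; exact h₂
  have eP : P + β • (P * E * P) = P * (E * W⁻¹) := by
    rw [e₂, mul_add, mul_one, Matrix.mul_smul, mul_assoc]
  have eS : S + β • (S * C * S) = W⁻¹ * C * S := by
    rw [e₁, add_mul, one_mul, Matrix.smul_mul]
  rw [eP, eS, hX]
  calc P * (E * W⁻¹) - W⁻¹ * C * S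
      = W⁻¹ * (C * (W⁻¹ - β • S)) * W * P * E * W⁻¹
        - W⁻¹ * C * S * W * ((W⁻¹ - β • P) * E) * W⁻¹ := by
        rw [h₃, h₄]
        simp only [mul_one, w₂, one_mul]
        simp only [mul_assoc, w₁, mul_one]
    _ = _ := by noncomm_ring

/-- With `Δ = P - S`, the difference is a congruence of the risk adjustment of `Δ` itself, with `W⁻¹
- βP` replacing `W⁻¹` and `-β` replacing `β`. Positivity is then `riskAdjust_posSemidef`; for `β ≥
0` dropping the negative correction leaves the linear upper bound. -/
lemma riskAdjust_sub_posSemidef {S P W : Matrix (Fin m) (Fin m) ℝ} {β : ℝ} (hW : W.PosDef)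
    (hPS : (P - S).PosSemidef) (hS : (W⁻¹ - β • S).PosDef) (hP : (W⁻¹ - β • P).PosDef) :
    (riskAdjust W β P - riskAdjust W β S).PosSemidef ∧
    (0 ≤ β → (W⁻¹ * (W⁻¹ - β • P)⁻¹ * (P - S) * (W⁻¹ - β • P)⁻¹ * W⁻¹ -
      (riskAdjust W β P - riskAdjust W β S)).PosSemidef) := by
  have key : W⁻¹ - β • S = (W⁻¹ - β • P) - (-β) • (P - S) := by
    rw [neg_smul, smul_sub]; abel
  have hS' := hS
  rw [key] at hS'
  have h₁ := riskAdjust_posSemidef hPS hP hS'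
  rw [← key] at h₁
  have hEs := isSymm_inv_of_posDef hP
  have hWs := isSymm_inv_of_posDef hW
  have e : riskAdjust W β P - riskAdjust W β S = ((W⁻¹ - β • P)⁻¹ * W⁻¹)ᵀ *
      (P - S + (-β) • ((P - S) * (W⁻¹ - β • S)⁻¹ * (P - S))) * ((W⁻¹ - β • P)⁻¹ * W⁻¹) := by
    rw [riskAdjust_sub hW hS hP, Matrix.transpose_mul, hEs, hWs]
    have : (W⁻¹ - β • P)⁻¹ * (P - S + (-β) • ((P - S) * (W⁻¹ - β • S)⁻¹ * (P - S)))
        = (W⁻¹ - β • S)⁻¹ * (P - S) := by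
      have h := mul_inv_of_posDef hS
      have h' : (W⁻¹ - β • P) * (W⁻¹ - β • S)⁻¹ = 1 - β • ((P - S) * (W⁻¹ - β • S)⁻¹) := by
        rw [← h, ← Matrix.smul_mul, ← sub_mul]
        congr 1
        rw [smul_sub]; abel
      calc _ = (W⁻¹ - β • P)⁻¹ * ((1 - β • ((P - S) * (W⁻¹ - β • S)⁻¹)) * (P - S)) := by
            rw [sub_mul 1, one_mul, Matrix.smul_mul, neg_smul, ← sub_eq_add_neg]
        _ = _ := by
          rw [← h', mul_assoc (W⁻¹ - β • P), ← mul_assoc, inv_mul_of_posDef hP, one_mul]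
    calc _ = W⁻¹ * ((W⁻¹ - β • S)⁻¹ * (P - S)) * ((W⁻¹ - β • P)⁻¹ * W⁻¹) := by
          simp only [mul_assoc]
      _ = _ := by rw [← this]; simp only [mul_assoc]
  constructor
  · rw [e]
    exact posSemidef_transpose_mul_mul_same h₁ _
  · intro hβ
    have h₂ : (β • ((P - S) * (W⁻¹ - β • S)⁻¹ * (P - S))).PosSemidef := by
      refine Matrix.PosSemidef.smul ?_ hβ
      have := posSemidef_transpose_mul_mul_same hS.inv.posSemidef (P - S)
      rwa [isSymm_of_posSemidef hPS] at this
    convert posSemidef_transpose_mul_mul_same h₂ ((W⁻¹ - β • P)⁻¹ * W⁻¹) using 1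
    rw [e, Matrix.transpose_mul, hEs, hWs]
    simp only [mul_assoc, mul_add, add_mul, neg_smul, mul_neg, neg_mul]
    abel

lemma posDef_sub_smul_of_le {T S P : Matrix (Fin m) (Fin m) ℝ} {β : ℝ} (hT : T.PosDef)
    (hS : S.PosSemidef) (hPS : (P - S).PosSemidef) (hP : (T - β • P).PosDef) :
    (T - β • S).PosDef := by
  rcases le_total 0 β with hβ | hβ
  · convert hP.add_posSemidef (hPS.smul hβ) using 1
    rw [smul_sub]; abel
  · convert hT.add_posSemidef (hS.smul (neg_nonneg.2 hβ)) using 1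
    rw [neg_smul, sub_eq_add_neg]

section Iterates

variable {L F W P : Matrix (Fin m) (Fin m) ℝ} {β : ℝ}

lemma riccatiIter_bounds (hL : L.PosDef) (hW : W.PosDef) (hP : P.PosSemidef)
    (hfix : P = L + Fᵀ * riskAdjust W β P * F) (hWP : (W⁻¹ - β • P).PosDef) (n : ℕ) :
    (riccatiIter L F W β n).PosSemidef ∧ (P - riccatiIter L F W β n).PosSemidef := by
  induction n with
  | zero => simpa [riccatiIter, Matrix.PosSemidef.zero] using hP
  | succ n ih =>
    have hS := posDef_sub_smul_of_le hW.inv ih.1 ih.2 hWP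
    constructor
    · exact hL.posSemidef.add
        (posSemidef_transpose_mul_mul_same (riskAdjust_posSemidef ih.1 hW.inv hS) _)
    · convert posSemidef_transpose_mul_mul_same
        (riskAdjust_sub_posSemidef hW ih.2 hS hWP).1 F using 1
      conv_lhs => rw [hfix]
      simp only [riccatiIter, mul_sub, sub_mul]
      abel

lemma posDef_sub_riccatiIter (hL : L.PosDef) (hW : W.PosDef) (hP : P.PosSemidef)
    (hfix : P = L + Fᵀ * riskAdjust W β P * F) (hWP : (W⁻¹ - β • P).PosDef)
    {T : Matrix (Fin m) (Fin m) ℝ} (hT : T.PosDef) (hTP : (T - β • P).PosDef) (n : ℕ) :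
    (T - β • riccatiIter L F W β n).PosDef :=
  have h := riccatiIter_bounds hL hW hP hfix hWP n
  posDef_sub_smul_of_le hT h.1 h.2 hTP

lemma sub_riccatiIter_succ (hL : L.PosDef) (hW : W.PosDef) (hP : P.PosSemidef)
    (hfix : P = L + Fᵀ * riskAdjust W β P * F) (hWP : (W⁻¹ - β • P).PosDef) (n : ℕ) :
    P - riccatiIter L F W β (n + 1) = (Fᵀ * W⁻¹ * (W⁻¹ - β • P)⁻¹) *
      (P - riccatiIter L F W β n) * ((W⁻¹ - β • riccatiIter L F W β n)⁻¹ * W⁻¹ * F) := by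
  have hS := posDef_sub_riccatiIter hL hW hP hfix hWP hW.inv hWP n
  have hb := riccatiIter_bounds hL hW hP hfix hWP n
  -- The roles of `P` and the iterate are exchanged so that the inverse belonging to `P`, which does
  -- not depend on `n`, stands on the left.
  have h := riskAdjust_sub hW hWP hS
  conv_lhs => rw [hfix]
  rw [← neg_sub (riskAdjust W β P), ← neg_sub P, mul_neg, neg_mul, neg_mul, neg_inj] at h
  have : L + Fᵀ * riskAdjust W β P * F - riccatiIter L F W β (n + 1)
      = Fᵀ * (riskAdjust W β P - riskAdjust W β (riccatiIter L F W β n)) * F := by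
    simp only [riccatiIter, mul_sub, sub_mul]; abel
  rw [this, h]
  simp only [mul_assoc]

end Iterates

end LEQG

/-! ### Convergence of the Riccati iterates to the stabilizing solution. -/

namespace LEQG

variable {m d : ℕ}

section PowTendsto
attribute [local instance] Matrix.linftyOpNormedRing Matrix.linftyOpNormedAlgebra

/-- Gelfand's formula: for `r` strictly between the spectral radius and `1`, the norm of the `n`-th
power is eventually at most `rⁿ`. -/
lemma tendsto_pow_apply_of_spectrallyStable {H : Matrix (Fin m) (Fin m) ℝ}
    (hH : SpectrallyStable H) (i j : Fin m) :
    Tendsto (fun n : ℕ => (H ^ n) i j) atTop (𝓝 0) := by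
  set Z : Matrix (Fin m) (Fin m) ℂ := H.map (algebraMap ℝ ℂ) with hZ
  obtain ⟨r, hr₁, hr₂⟩ := ENNReal.lt_iff_exists_nnreal_btwn.1 hH
  have hr₂' : r < 1 := by exact_mod_cast hr₂
  have hg := spectrum.pow_nnnorm_pow_one_div_tendsto_nhds_spectralRadius Z
  have hle : ∀ᶠ n : ℕ in atTop, ‖(H ^ n) i j‖ ≤ (r : ℝ) ^ n := by
    filter_upwards [hg.eventually (gt_mem_nhds hr₁), eventually_gt_atTop 0] with n hn hn0
    have h₁ : (‖Z ^ n‖₊ : ENNReal) ≤ (r : ENNReal) ^ n := by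
      have := ENNReal.rpow_le_rpow hn.le (z := (n : ℝ)) (by positivity)
      rwa [← ENNReal.rpow_mul, one_div, inv_mul_cancel₀ (by positivity), ENNReal.rpow_one,
        ENNReal.rpow_natCast] at this
    have h₂ : ‖Z ^ n‖ ≤ (r : ℝ) ^ n := by exact_mod_cast h₁
    have h₃ : (Z ^ n) i j = (((H ^ n) i j : ℝ) : ℂ) := by
      rw [hZ, ← Matrix.map_pow]; rfl
    have h₄ : ‖(Z ^ n) i j‖ ≤ ‖Z ^ n‖ := by
      rw [Matrix.linfty_opNorm_def]
      have h₅ : ‖(Z ^ n) i j‖₊ ≤ ∑ k, ‖(Z ^ n) i k‖₊ :=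
        Finset.single_le_sum (f := fun k => ‖(Z ^ n) i k‖₊) (fun _ _ => zero_le)
          (Finset.mem_univ j)
      exact_mod_cast h₅.trans (Finset.le_sup (f := fun i => ∑ k, ‖(Z ^ n) i k‖₊)
        (Finset.mem_univ i))
    rw [h₃, Complex.norm_real] at h₄
    exact h₄.trans h₂
  exact squeeze_zero_norm' hle (tendsto_pow_atTop_nhds_zero_of_lt_one r.2 hr₂')

end PowTendsto

lemma tendsto_pow_of_spectrallyStable {H : Matrix (Fin m) (Fin m) ℝ}
    (hH : SpectrallyStable H) : Tendsto (fun n : ℕ => H ^ n) atTop (𝓝 0) :=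
  tendsto_pi_nhds.2 fun i => tendsto_pi_nhds.2 fun j =>
    tendsto_pow_apply_of_spectrallyStable hH i j

lemma two_mul_abs_apply_le_of_posSemidef {D : Matrix (Fin m) (Fin m) ℝ} (hD : D.PosSemidef)
    (i j : Fin m) : 2 * |D i j| ≤ D i i + D j j := by
  have hs : D j i = D i j := congrFun (congrFun (isSymm_of_posSemidef hD) i) j
  have h₁ := hD.dotProduct_mulVec_nonneg (Pi.single i 1 + Pi.single j 1)
  have h₂ := hD.dotProduct_mulVec_nonneg (Pi.single i 1 - Pi.single j 1)
  simp only [star_trivial, Matrix.mulVec_add, Matrix.mulVec_sub, Matrix.mulVec_single_one,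
    add_dotProduct, sub_dotProduct, single_one_dotProduct, Pi.add_apply, Pi.sub_apply,
    Matrix.col_apply, hs] at h₁ h₂
  rcases abs_cases (D i j) with h | h <;> linarith

/-- Symmetric matrices squeezed between `0` and a null sequence tend to zero. -/
lemma tendsto_zero_of_posSemidef_le {D E : ℕ → Matrix (Fin m) (Fin m) ℝ}
    (hD : ∀ n, (D n).PosSemidef) (hDE : ∀ n, (E n - D n).PosSemidef)
    (hE : Tendsto E atTop (𝓝 0)) : Tendsto D atTop (𝓝 0) := by
  have hE' : ∀ i, Tendsto (fun n => E n i i) atTop (𝓝 0) := fun i =>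
    tendsto_pi_nhds.1 (tendsto_pi_nhds.1 hE i) i
  refine tendsto_pi_nhds.2 fun i => tendsto_pi_nhds.2 fun j => ?_
  refine squeeze_zero_norm (a := fun n => E n i i + E n j j) (fun n => ?_) ?_
  · have h₁ := two_mul_abs_apply_le_of_posSemidef (hD n) i j
    have h₂ := (hDE n).diag_nonneg (i := i)
    have h₃ := (hDE n).diag_nonneg (i := j)
    rw [Matrix.sub_apply] at h₂ h₃
    have := abs_nonneg ((D n) i j)
    rw [Real.norm_eq_abs]
    linarith
  · simpa using (hE' i).add (hE' j)

/-- The product of a null sequence with an entrywise bounded sequence tends to zero. -/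
lemma tendsto_mul_zero_of_bounded {D E : ℕ → Matrix (Fin m) (Fin m) ℝ} {c : Fin m → Fin m → ℝ}
    (hD : Tendsto D atTop (𝓝 0)) (hE : ∀ n i j, |E n i j| ≤ c i j) :
    Tendsto (fun n => D n * E n) atTop (𝓝 0) := by
  refine tendsto_pi_nhds.2 fun i => tendsto_pi_nhds.2 fun j => ?_
  simp only [Matrix.mul_apply]
  rw [Matrix.zero_apply, ← Finset.sum_const_zero (s := (Finset.univ : Finset (Fin m)))]
  refine tendsto_finsetSum _ fun k _ => ?_
  have h : Tendsto (fun n => D n i k) atTop (𝓝 0) := tendsto_pi_nhds.1 (tendsto_pi_nhds.1 hD i) k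
  refine h.zero_mul_isBoundedUnder_le (isBoundedUnder_of ⟨c k j, fun n => ?_⟩)
  simpa using hE n k j

section Sqrt
open scoped MatrixOrder

lemma transpose_sqrt (W : Matrix (Fin m) (Fin m) ℝ) : (CFC.sqrt W)ᵀ = CFC.sqrt W :=
  isSymm_of_posSemidef (Matrix.nonneg_iff_posSemidef.1 (CFC.sqrt_nonneg W))

lemma sqrt_mul_sqrt_of_posDef {W : Matrix (Fin m) (Fin m) ℝ} (hW : W.PosDef) :
    CFC.sqrt W * CFC.sqrt W = W :=
  CFC.sqrt_mul_sqrt_self W hW.posSemidef.nonneg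

lemma isUnit_det_sqrt_of_posDef {W : Matrix (Fin m) (Fin m) ℝ} (hW : W.PosDef) :
    IsUnit (CFC.sqrt W).det := by
  have h := hW.det_pos.ne'
  rw [← sqrt_mul_sqrt_of_posDef hW, Matrix.det_mul] at h
  exact isUnit_iff_ne_zero.2 (left_ne_zero_of_mul h)

lemma exists_transpose_mul_self_of_posDef {L : Matrix (Fin m) (Fin m) ℝ} (hL : L.PosDef) :
    ∃ U : Matrix (Fin m) (Fin m) ℝ, IsUnit U.det ∧ L = Uᵀ * U :=
  ⟨CFC.sqrt L, isUnit_det_sqrt_of_posDef hL, by rw [transpose_sqrt, sqrt_mul_sqrt_of_posDef hL]⟩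

end Sqrt

section Iterates

variable {L F W P : Matrix (Fin m) (Fin m) ℝ} {β : ℝ}

/-- Iterates the linear upper bound `P - S_{n+1} ≤ H (P - S_n) Hᵀ`, valid because `β ≥ 0`. -/
lemma posSemidef_pow_bound (hL : L.PosDef) (hW : W.PosDef) (hP : P.PosSemidef)
    (hfix : P = L + Fᵀ * riskAdjust W β P * F) (hWP : (W⁻¹ - β • P).PosDef) (hβ : 0 ≤ β) (n : ℕ) :
    ((Fᵀ * W⁻¹ * (W⁻¹ - β • P)⁻¹) ^ n * P * ((Fᵀ * W⁻¹ * (W⁻¹ - β • P)⁻¹) ^ n)ᵀ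
      - (P - riccatiIter L F W β n)).PosSemidef := by
  set H := Fᵀ * W⁻¹ * (W⁻¹ - β • P)⁻¹ with hH
  induction n with
  | zero => simpa [riccatiIter] using Matrix.PosSemidef.zero
  | succ n ih =>
    have hS := posDef_sub_riccatiIter hL hW hP hfix hWP hW.inv hWP n
    have hb := riccatiIter_bounds hL hW hP hfix hWP n
    have h₁ := posSemidef_transpose_mul_mul_same
      ((riskAdjust_sub_posSemidef hW hb.2 hS hWP).2 hβ) F
    have h₂ := posSemidef_transpose_mul_mul_same ih Hᵀ
    have hHt : Hᵀ = (W⁻¹ - β • P)⁻¹ * W⁻¹ * F := by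
      rw [hH, Matrix.transpose_mul, Matrix.transpose_mul, isSymm_inv_of_posDef hWP,
        isSymm_inv_of_posDef hW, Matrix.transpose_transpose, mul_assoc]
    convert h₁.add h₂ using 1
    have e : P - riccatiIter L F W β (n + 1)
        = Fᵀ * (riskAdjust W β P - riskAdjust W β (riccatiIter L F W β n)) * F := by
      conv_lhs => rw [hfix]
      simp only [riccatiIter, mul_sub, sub_mul]; abel
    rw [e, pow_succ', Matrix.transpose_mul, Matrix.transpose_transpose]
    have e₂ : Fᵀ * (W⁻¹ * (W⁻¹ - β • P)⁻¹ * (P - riccatiIter L F W β n) * (W⁻¹ - β • P)⁻¹ * W⁻¹)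
        * F = H * (P - riccatiIter L F W β n) * Hᵀ := by
      rw [hHt, hH]; simp only [mul_assoc]
    generalize riskAdjust W β P - riskAdjust W β (riccatiIter L F W β n) = R
    generalize P - riccatiIter L F W β n = D at e₂ ⊢
    rw [mul_sub Fᵀ, sub_mul _ _ F, e₂]
    simp only [mul_sub, sub_mul, mul_assoc]
    abel

/-- Products of the closed-loop matrices along the Riccati iterates. -/
noncomputable def closedLoopProd (L F W : Matrix (Fin m) (Fin m) ℝ) (β : ℝ) :
    ℕ → Matrix (Fin m) (Fin m) ℝ
  | 0 => 1
  | n + 1 => closedLoopProd L F W β n *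
      ((W⁻¹ - β • riccatiIter L F W β (n + 1))⁻¹ * W⁻¹ * F)

lemma sub_riccatiIter_eq (hL : L.PosDef) (hW : W.PosDef) (hP : P.PosSemidef)
    (hfix : P = L + Fᵀ * riskAdjust W β P * F) (hWP : (W⁻¹ - β • P).PosDef) (n : ℕ) :
    P - riccatiIter L F W β (n + 1) = (Fᵀ * W⁻¹ * (W⁻¹ - β • P)⁻¹) ^ n *
      (P - riccatiIter L F W β 1) * closedLoopProd L F W β n := by
  induction n with
  | zero => simp [closedLoopProd]
  | succ n ih =>
    rw [sub_riccatiIter_succ hL hW hP hfix hWP, ih, pow_succ', closedLoopProd]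
    simp only [mul_assoc]

/-- For `β ≤ 0`, `S_{n+1} ≥ L + G_nᵀ S_n G_n`; the extra `L` is dropped at each step. Products start
at index `1` because `S_1 = L`, whereas `S_0 = 0` gives no bound. -/
lemma closedLoopProd_congr_le (hL : L.PosDef) (hW : W.PosDef) (hP : P.PosSemidef)
    (hfix : P = L + Fᵀ * riskAdjust W β P * F) (hWP : (W⁻¹ - β • P).PosDef) (hβ : β ≤ 0) (n : ℕ) :
    (riccatiIter L F W β (n + 1) -
      (closedLoopProd L F W β n)ᵀ * L * closedLoopProd L F W β n).PosSemidef := by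
  induction n with
  | zero =>
    simp [closedLoopProd, riccatiIter, riskAdjust, Matrix.PosSemidef.zero]
  | succ n ih =>
    have hS := posDef_sub_riccatiIter hL hW hP hfix hWP hW.inv hWP (n + 1)
    have hb := riccatiIter_bounds hL hW hP hfix hWP (n + 1)
    have h₁ := posSemidef_transpose_mul_mul_same
      (riskAdjust_sub_congr_posSemidef hβ hb.1 hW.inv hS) F
    set S := riccatiIter L F W β (n + 1) with hSdef
    have h₂ := posSemidef_transpose_mul_mul_same ih ((W⁻¹ - β • S)⁻¹ * W⁻¹ * F)
    convert (hL.posSemidef.add h₁).add h₂ using 1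
    rw [riccatiIter, ← hSdef, closedLoopProd, ← hSdef]
    simp only [Matrix.transpose_mul, isSymm_inv_of_posDef hS, isSymm_inv_of_posDef hW, riskAdjust,
      mul_sub, sub_mul, mul_assoc]
    abel

lemma tendsto_riccatiIter (hL : L.PosDef) (hW : W.PosDef) (hP : P.PosSemidef)
    (hfix : P = L + Fᵀ * riskAdjust W β P * F) (hWP : (W⁻¹ - β • P).PosDef)
    (hstab : SpectrallyStable (Fᵀ * W⁻¹ * (W⁻¹ - β • P)⁻¹)) :
    Tendsto (riccatiIter L F W β) atTop (𝓝 P) := by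
  have hH := tendsto_pow_of_spectrallyStable hstab
  suffices h : Tendsto (fun n => P - riccatiIter L F W β n) atTop (𝓝 0) by
    simpa using h.const_sub P
  rcases le_total 0 β with hβ | hβ
  · refine tendsto_zero_of_posSemidef_le
      (fun n => (riccatiIter_bounds hL hW hP hfix hWP n).2)
      (fun n => posSemidef_pow_bound hL hW hP hfix hWP hβ n) ?_
    have hc : Continuous fun M : Matrix (Fin m) (Fin m) ℝ => M * P * Mᵀ := by fun_prop
    have h := (hc.tendsto 0).comp hH
    rw [Matrix.zero_mul, Matrix.zero_mul] at h
    exact h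
  · rw [← tendsto_add_atTop_iff_nat 1]
    obtain ⟨U, hdet, hLU⟩ := exists_transpose_mul_self_of_posDef hL
    have e : ∀ n, P - riccatiIter L F W β (n + 1) =
        ((Fᵀ * W⁻¹ * (W⁻¹ - β • P)⁻¹) ^ n * ((P - riccatiIter L F W β 1) * U⁻¹)) *
          (U * closedLoopProd L F W β n) := fun n => by
      rw [sub_riccatiIter_eq hL hW hP hfix hWP]
      simp only [mul_assoc]
      rw [← mul_assoc U⁻¹, Matrix.nonsing_inv_mul _ hdet, one_mul]
    refine Tendsto.congr (fun n => (e n).symm) ?_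
    -- With `L = UᵀU` and `Π_n` the closed-loop product, `(U Π_n)ᵀ(U Π_n) ≤ S_{n+1} ≤ P`; the `j`-th
    -- diagonal entry bounds column `j` of `U Π_n`.
    refine tendsto_mul_zero_of_bounded (c := fun _ j => √(P j j)) ?_ fun n i j => ?_
    · have h := Tendsto.mul_const ((P - riccatiIter L F W β 1) * U⁻¹) hH
      rwa [Matrix.zero_mul] at h
    · have h₁ := ((closedLoopProd_congr_le hL hW hP hfix hWP hβ n).add
        (riccatiIter_bounds hL hW hP hfix hWP (n + 1)).2).diag_nonneg (i := j)
      have h₂ : (closedLoopProd L F W β n)ᵀ * L * closedLoopProd L F W β n =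
          (U * closedLoopProd L F W β n)ᵀ * (U * closedLoopProd L F W β n) := by
        rw [hLU, Matrix.transpose_mul]; simp only [mul_assoc]
      rw [h₂, Matrix.add_apply, Matrix.sub_apply, Matrix.sub_apply, Matrix.mul_apply] at h₁
      simp only [Matrix.transpose_apply] at h₁
      have h₃ := Finset.single_le_sum
        (f := fun k => (U * closedLoopProd L F W β n) k j * (U * closedLoopProd L F W β n) k j)
        (fun k _ => mul_self_nonneg _) (Finset.mem_univ i)
      refine Real.abs_le_sqrt ?_
      rw [sq]
      linarith

end Iterates

end LEQG

/-! ### Gaussian integrals of exponentials of quadratic forms. -/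

namespace LEQG

variable {m d : ℕ}

lemma integral_exp_quadratic_gaussianReal {a : ℝ} (ha : 0 < a) (b : ℝ) :
    Integrable (fun x => Real.exp (1 / 2 * ((1 - a) * x ^ 2) + b * x)) (gaussianReal 0 1) ∧
    ∫ x, Real.exp (1 / 2 * ((1 - a) * x ^ 2) + b * x) ∂(gaussianReal 0 1) =
      (√a)⁻¹ * Real.exp (1 / 2 * (b * (b / a))) := by
  have key : ∀ x : ℝ, gaussianPDFReal 0 1 x • Real.exp (1 / 2 * ((1 - a) * x ^ 2) + b * x) =
      (√(2 * Real.pi))⁻¹ * Real.exp (1 / 2 * (b * (b / a))) *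
        Real.exp (-(a / 2) * (x - b / a) ^ 2) := by
    intro x
    simp only [gaussianPDFReal, NNReal.coe_one, mul_one, sub_zero, smul_eq_mul]
    rw [mul_assoc, mul_assoc, ← Real.exp_add, ← Real.exp_add]
    congr 2
    field_simp
    ring
  constructor
  · rw [gaussianReal_of_var_ne_zero 0 one_ne_zero,
      integrable_withDensity_iff_integrable_smul' (measurable_gaussianPDF 0 1)
        (ae_of_all _ fun _ => gaussianPDF_lt_top)]
    simp_rw [toReal_gaussianPDF, key]
    exact ((integrable_exp_neg_mul_sq (half_pos ha)).comp_sub_right (b / a)).const_mul _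
  · rw [integral_gaussianReal_eq_integral_smul one_ne_zero]
    simp_rw [key]
    rw [integral_const_mul, integral_sub_right_eq_self (fun x => Real.exp (-(a / 2) * x ^ 2)),
      integral_gaussian, div_div_eq_mul_div, mul_comm Real.pi 2, Real.sqrt_div (by positivity)]
    have : √(2 * Real.pi) ≠ 0 := by positivity
    field_simp

/-- The standard Gaussian has independent standard coordinates in an eigenbasis of `M`, so the
integral splits into one-dimensional ones. Writing the linear term as `M v` keeps `M⁻¹` out of the
result. -/
lemma integral_exp_quadratic_stdGaussian {M : Matrix (Fin m) (Fin m) ℝ} (hM : M.PosDef)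
    (v : EuclideanSpace ℝ (Fin m)) :
    Integrable (fun z : EuclideanSpace ℝ (Fin m) => Real.exp (1 / 2 *
      (z.ofLp ⬝ᵥ z.ofLp - z.ofLp ⬝ᵥ M *ᵥ z.ofLp) + (M *ᵥ v.ofLp) ⬝ᵥ z.ofLp))
      (stdGaussian (EuclideanSpace ℝ (Fin m))) ∧
    ∫ z : EuclideanSpace ℝ (Fin m), Real.exp (1 / 2 *
      (z.ofLp ⬝ᵥ z.ofLp - z.ofLp ⬝ᵥ M *ᵥ z.ofLp) + (M *ᵥ v.ofLp) ⬝ᵥ z.ofLp)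
      ∂(stdGaussian (EuclideanSpace ℝ (Fin m))) =
      (√M.det)⁻¹ * Real.exp (1 / 2 * ((M *ᵥ v.ofLp) ⬝ᵥ v.ofLp)) := by
  set e := hM.isHermitian.eigenvectorBasis with he
  set a := hM.isHermitian.eigenvalues with ha
  have ha0 : ∀ i, 0 < a i := hM.eigenvalues_pos
  set b : Fin m → ℝ := fun i => inner ℝ v (e i) with hb
  have hdot : ∀ x y : EuclideanSpace ℝ (Fin m), x.ofLp ⬝ᵥ y.ofLp = inner ℝ y x := fun x y => by
    simp [EuclideanSpace.inner_eq_star_dotProduct]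
  have hMx : ∀ x : Fin m → ℝ, M *ᵥ (∑ i, x i • e i : EuclideanSpace ℝ (Fin m)).ofLp =
      (∑ i, (a i * x i) • e i : EuclideanSpace ℝ (Fin m)).ofLp := by
    intro x
    simp only [WithLp.ofLp_sum, WithLp.ofLp_smul, Matrix.mulVec_sum, Matrix.mulVec_smul, he,
      Matrix.IsHermitian.mulVec_eigenvectorBasis, smul_smul, mul_comm]
    rfl
  have hv : v = ∑ i, b i • e i := by
    rw [← e.sum_repr v]
    simp [hb, e.repr_apply_apply, real_inner_comm]
  have hsum : ∀ x y : Fin m → ℝ, inner ℝ (∑ i, x i • e i) (∑ i, y i • e i) = ∑ i, x i * y i :=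
    fun x y => by rw [e.orthonormal.inner_sum]; simp
  have hval : ∀ x : Fin m → ℝ, Real.exp (1 / 2 *
      ((∑ i, x i • e i : EuclideanSpace ℝ (Fin m)).ofLp ⬝ᵥ
        (∑ i, x i • e i : EuclideanSpace ℝ (Fin m)).ofLp
        - (∑ i, x i • e i : EuclideanSpace ℝ (Fin m)).ofLp ⬝ᵥ
          M *ᵥ (∑ i, x i • e i : EuclideanSpace ℝ (Fin m)).ofLp)
        + (M *ᵥ v.ofLp) ⬝ᵥ (∑ i, x i • e i : EuclideanSpace ℝ (Fin m)).ofLp) =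
      ∏ i, Real.exp (1 / 2 * ((1 - a i) * x i ^ 2) + (a i * b i) * x i) := by
    intro x
    rw [← Real.exp_sum, hMx, hv, hMx, hdot, hdot, hdot, hsum, hsum, hsum, ← Finset.sum_sub_distrib,
      Finset.mul_sum, ← Finset.sum_add_distrib]
    congr 1
    refine Finset.sum_congr rfl fun i _ => ?_
    ring
  have hmeas : AEMeasurable (fun x : Fin m → ℝ => ∑ i, x i • e i)
      (Measure.pi fun _ : Fin m => gaussianReal 0 1) := Measurable.aemeasurable (by fun_prop)
  have hcont : Continuous fun z : EuclideanSpace ℝ (Fin m) => Real.exp (1 / 2 *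
      (z.ofLp ⬝ᵥ z.ofLp - z.ofLp ⬝ᵥ M *ᵥ z.ofLp) + (M *ᵥ v.ofLp) ⬝ᵥ z.ofLp) := by fun_prop
  rw [stdGaussian_eq_map_pi_orthonormalBasis e]
  constructor
  · rw [integrable_map_measure hcont.aestronglyMeasurable hmeas]
    simp only [Function.comp_def, hval]
    exact Integrable.fintype_prod fun i => (integral_exp_quadratic_gaussianReal (ha0 i) _).1
  · rw [integral_map hmeas hcont.aestronglyMeasurable]
    simp only [hval]
    rw [integral_fintype_prod_eq_prod
      (fun i x => Real.exp (1 / 2 * ((1 - a i) * x ^ 2) + (a i * b i) * x))]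
    simp only [(integral_exp_quadratic_gaussianReal (ha0 _) _).2]
    rw [Finset.prod_mul_distrib, ← Real.exp_sum, Finset.prod_inv_distrib,
      ← Real.sqrt_prod _ (fun i _ => (ha0 i).le), hM.isHermitian.det_eq_prod_eigenvalues]
    congr 2
    rw [hv, hMx, hdot, hsum, Finset.mul_sum]
    refine Finset.sum_congr rfl fun i _ => ?_
    have := (ha0 i).ne'
    field_simp

open scoped MatrixOrder in
/-- The Gaussian expectation of the exponential of a shifted quadratic form. -/
lemma lintegral_exp_quadratic_multivariateGaussian {W S : Matrix (Fin m) (Fin m) ℝ} {β : ℝ}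
    (hW : W.PosDef) (hS : S.PosSemidef) (hWS : (W⁻¹ - β • S).PosDef)
    (y : EuclideanSpace ℝ (Fin m)) :
    ∫⁻ w, ENNReal.ofReal (Real.exp (β / 2 * ((y + w).ofLp ⬝ᵥ S *ᵥ (y + w).ofLp)))
      ∂(multivariateGaussian 0 W) =
    ENNReal.ofReal (√(1 - β • (S * W)).det)⁻¹ *
      ENNReal.ofReal (Real.exp (β / 2 * (y.ofLp ⬝ᵥ riskAdjust W β S *ᵥ y.ofLp))) := by
  set V := CFC.sqrt W with hV
  have hVt : Vᵀ = V := transpose_sqrt W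
  have hVV : V * V = W := sqrt_mul_sqrt_of_posDef hW
  have hVu : IsUnit V.det := isUnit_det_sqrt_of_posDef hW
  have hv₁ : V * V⁻¹ = 1 := Matrix.mul_nonsing_inv _ hVu
  have hv₂ : V⁻¹ * V = 1 := Matrix.nonsing_inv_mul _ hVu
  have hWi : W⁻¹ = V⁻¹ * V⁻¹ := by rw [← hVV, Matrix.mul_inv_rev]
  have hSs := isSymm_of_posSemidef hS
  have hMe : V * (W⁻¹ - β • S) * V = 1 - β • (V * S * V) := by
    rw [hWi]
    simp only [mul_sub, sub_mul, Matrix.mul_smul, Matrix.smul_mul, mul_assoc, hv₂, hv₁, mul_one]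
  have hM : (1 - β • (V * S * V)).PosDef := by
    rw [← hMe]
    have := hWS.conjTranspose_mul_mul_same (B := V)
      (Matrix.mulVec_injective_of_isUnit ((Matrix.isUnit_iff_isUnit_det _).2 hVu))
    simpa [hVt] using this
  -- Sylvester's determinant identity moves one factor `V` to the other side.
  have hdet : (1 - β • (V * S * V)).det = (1 - β • (S * W)).det := by
    rw [← hVV, mul_assoc V, ← Matrix.mul_smul, Matrix.det_one_sub_mul_comm, Matrix.smul_mul,
      mul_assoc S]
  set C := (W⁻¹ - β • S)⁻¹ with hC
  set s := S *ᵥ y.ofLp with hs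
  -- The solution of `M v = β V s` for `M = V C⁻¹ V`, which completes the square.
  set v : EuclideanSpace ℝ (Fin m) := WithLp.toLp 2 ((β • (V⁻¹ * C)) *ᵥ s) with hvdef
  have hMv : (1 - β • (V * S * V)) *ᵥ v.ofLp = β • (V *ᵥ s) := by
    rw [hvdef, ← hMe, Matrix.mulVec_mulVec, Matrix.mul_smul, mul_assoc (V * _), ← mul_assoc V V⁻¹,
      hv₁, one_mul, mul_assoc, mul_inv_of_posDef hWS, mul_one, Matrix.smul_mulVec]
  have hVdot : ∀ x z : Fin m → ℝ, (V *ᵥ x) ⬝ᵥ z = x ⬝ᵥ V *ᵥ z := fun x z => by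
    rw [Matrix.dotProduct_mulVec, ← Matrix.mulVec_transpose, hVt]
  have hSdot : ∀ x z : Fin m → ℝ, (S *ᵥ x) ⬝ᵥ z = x ⬝ᵥ S *ᵥ z := fun x z => by
    rw [Matrix.dotProduct_mulVec, ← Matrix.mulVec_transpose, hSs]
  have hexp : ∀ z : EuclideanSpace ℝ (Fin m),
      β / 2 * ((y + (0 + Matrix.toEuclideanCLM (𝕜 := ℝ) V z)).ofLp ⬝ᵥ
        S *ᵥ (y + (0 + Matrix.toEuclideanCLM (𝕜 := ℝ) V z)).ofLp) =
      β / 2 * (y.ofLp ⬝ᵥ s) + (1 / 2 *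
      (z.ofLp ⬝ᵥ z.ofLp - z.ofLp ⬝ᵥ (1 - β • (V * S * V)) *ᵥ z.ofLp)
        + ((1 - β • (V * S * V)) *ᵥ v.ofLp) ⬝ᵥ z.ofLp) := by
    intro z
    rw [hMv, zero_add, WithLp.ofLp_add, Matrix.ofLp_toEuclideanCLM, Matrix.sub_mulVec,
      Matrix.one_mulVec, Matrix.smul_mulVec, ← Matrix.mulVec_mulVec, ← Matrix.mulVec_mulVec,
      Matrix.mulVec_add, add_dotProduct, dotProduct_add, dotProduct_add, dotProduct_sub,
      dotProduct_smul, smul_dotProduct, hVdot s, ← hVdot z.ofLp, ← hs,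
      dotProduct_comm (V *ᵥ z.ofLp) s, ← hSdot y.ofLp (V *ᵥ z.ofLp), ← hs]
    simp only [smul_eq_mul]
    ring
  have hconst : β / 2 * (y.ofLp ⬝ᵥ s) +
      1 / 2 * (((1 - β • (V * S * V)) *ᵥ v.ofLp) ⬝ᵥ v.ofLp) =
      β / 2 * (y.ofLp ⬝ᵥ riskAdjust W β S *ᵥ y.ofLp) := by
    rw [hMv, hvdef, riskAdjust, Matrix.add_mulVec, Matrix.smul_mulVec, Matrix.smul_mulVec,
      ← Matrix.mulVec_mulVec, ← Matrix.mulVec_mulVec, ← Matrix.mulVec_mulVec, smul_dotProduct,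
      dotProduct_smul, dotProduct_add, dotProduct_smul, hVdot, Matrix.mulVec_mulVec _ V, hv₁,
      Matrix.one_mulVec, ← hSdot y.ofLp (_ *ᵥ _), ← hs]
    simp only [smul_eq_mul]
    ring
  obtain ⟨hi, he⟩ := integral_exp_quadratic_stdGaussian hM v
  rw [multivariateGaussian, lintegral_map (by fun_prop) (by fun_prop)]
  simp_rw [← hV, hexp, Real.exp_add (β / 2 * (y.ofLp ⬝ᵥ s))]
  rw [← ofReal_integral_eq_lintegral_ofReal (hi.const_mul _) (ae_of_all _ fun _ => by positivity),
    integral_const_mul, he, mul_left_comm, ← Real.exp_add, hconst, hdet,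
    ENNReal.ofReal_mul (by positivity)]

end LEQG

/-! ### The state process: measurability and independence of the next noise. -/

namespace LEQG

variable {m d : ℕ} {Ω Ω' : Type*}

section Dynamics

variable (A : Matrix (Fin m) (Fin m) ℝ) (B : Matrix (Fin m) (Fin d) ℝ)
  (Q : Matrix (Fin m) (Fin m) ℝ) (R : Matrix (Fin d) (Fin d) ℝ) (K : Matrix (Fin d) (Fin m) ℝ)

lemma stageCost_feedback (x : EuclideanSpace ℝ (Fin m)) :
    stageCost Q R x (feedback K x) = x.ofLp ⬝ᵥ (Q + Kᵀ * R * K) *ᵥ x.ofLp := by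
  simp only [stageCost, feedback, Matrix.add_mulVec, dotProduct_add, ← Matrix.mulVec_mulVec,
    Matrix.mulVec_neg, neg_dotProduct, dotProduct_neg, neg_neg]
  congr 1
  rw [Matrix.dotProduct_mulVec x.ofLp, Matrix.vecMul_transpose]

lemma state_succ (x₀ : Ω → EuclideanSpace ℝ (Fin m)) (w : ℕ → Ω → EuclideanSpace ℝ (Fin m))
    (t : ℕ) (ω : Ω) :
    state A B K x₀ w (t + 1) ω =
      WithLp.toLp 2 ((A - B * K) *ᵥ (state A B K x₀ w t ω).ofLp) + w t ω := by
  rw [state, feedback, Matrix.mulVec_neg, Matrix.mulVec_mulVec, ← sub_eq_add_neg,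
    ← Matrix.sub_mulVec]

lemma state_congr {x₀ : Ω → EuclideanSpace ℝ (Fin m)} {w : ℕ → Ω → EuclideanSpace ℝ (Fin m)}
    {x₀' : Ω' → EuclideanSpace ℝ (Fin m)} {w' : ℕ → Ω' → EuclideanSpace ℝ (Fin m)}
    {ω : Ω} {ω' : Ω'} (h₀ : x₀ ω = x₀' ω') :
    ∀ t : ℕ, (∀ s < t, w s ω = w' s ω') → state A B K x₀ w t ω = state A B K x₀' w' t ω'
  | 0, _ => h₀
  | t + 1, h => by
    rw [state_succ, state_succ, state_congr h₀ t fun s hs => h s (by omega), h t (by omega)]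

lemma measurable_state [MeasurableSpace Ω] {x₀ : Ω → EuclideanSpace ℝ (Fin m)}
    {w : ℕ → Ω → EuclideanSpace ℝ (Fin m)} (h₀ : Measurable x₀) (hw : ∀ t, Measurable (w t)) :
    ∀ t, Measurable (state A B K x₀ w t)
  | 0 => h₀
  | t + 1 => by
    have hc : Continuous fun x : EuclideanSpace ℝ (Fin m) =>
      (WithLp.toLp 2 ((A - B * K) *ᵥ x.ofLp) : EuclideanSpace ℝ (Fin m)) := by fun_prop
    have := (hc.measurable.comp (measurable_state h₀ hw t)).add (hw t)
    rwa [show state A B K x₀ w (t + 1) = _ from funext fun ω => state_succ A B K x₀ w t ω]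

/-- The cost accumulated before time `t`. -/
noncomputable def cumCost (x₀ : Ω → EuclideanSpace ℝ (Fin m))
    (w : ℕ → Ω → EuclideanSpace ℝ (Fin m)) (t : ℕ) (ω : Ω) : ℝ :=
  ∑ s ∈ Finset.range t,
    stageCost Q R (state A B K x₀ w s ω) (feedback K (state A B K x₀ w s ω))

lemma continuous_stageCost_feedback :
    Continuous fun x : EuclideanSpace ℝ (Fin m) => stageCost Q R x (feedback K x) := by
  simp only [stageCost_feedback]
  fun_prop

/-- The state at time `t` together with the cost accumulated up to and including time `t`. -/
noncomputable def stateCost (x₀ : Ω → EuclideanSpace ℝ (Fin m))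
    (w : ℕ → Ω → EuclideanSpace ℝ (Fin m)) (t : ℕ) (ω : Ω) : EuclideanSpace ℝ (Fin m) × ℝ :=
  (state A B K x₀ w t ω, cumCost A B Q R K x₀ w (t + 1) ω)

lemma measurable_stateCost [MeasurableSpace Ω] {x₀ : Ω → EuclideanSpace ℝ (Fin m)}
    {w : ℕ → Ω → EuclideanSpace ℝ (Fin m)} (h₀ : Measurable x₀) (hw : ∀ t, Measurable (w t))
    (t : ℕ) : Measurable (stateCost A B Q R K x₀ w t) :=
  (measurable_state A B K h₀ hw t).prodMk (Finset.measurable_sum _ fun s _ =>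
    (continuous_stageCost_feedback Q R K).measurable.comp (measurable_state A B K h₀ hw s))

lemma stateCost_congr {x₀ : Ω → EuclideanSpace ℝ (Fin m)} {w : ℕ → Ω → EuclideanSpace ℝ (Fin m)}
    {x₀' : Ω' → EuclideanSpace ℝ (Fin m)} {w' : ℕ → Ω' → EuclideanSpace ℝ (Fin m)}
    {ω : Ω} {ω' : Ω'} (h₀ : x₀ ω = x₀' ω') {t : ℕ} (h : ∀ s < t, w s ω = w' s ω') :
    stateCost A B Q R K x₀ w t ω = stateCost A B Q R K x₀' w' t ω' := by
  have hs : ∀ s ≤ t, state A B K x₀ w s ω = state A B K x₀' w' s ω' := fun s hs =>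
    state_congr A B K h₀ s fun r hr => h r (by omega)
  refine Prod.ext (hs t le_rfl) ?_
  change cumCost A B Q R K x₀ w (t + 1) ω = cumCost A B Q R K x₀' w' (t + 1) ω'
  unfold cumCost
  refine Finset.sum_congr rfl fun s h' => ?_
  rw [hs s (by have := Finset.mem_range.1 h'; omega)]

/-- The state and the accumulated cost as a function of the noise preceding time `t`. -/
lemma exists_measurable_stateCost (t : ℕ) :
    ∃ φ : (({none} ∪ (Finset.range t).image some : Finset (Option ℕ)) →
        EuclideanSpace ℝ (Fin m)) → EuclideanSpace ℝ (Fin m) × ℝ,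
      Measurable φ ∧ ∀ (Ω : Type _) (x₀ : Ω → EuclideanSpace ℝ (Fin m))
        (w : ℕ → Ω → EuclideanSpace ℝ (Fin m)) (ω : Ω),
        stateCost A B Q R K x₀ w t ω = φ fun k => (k : Option ℕ).elim x₀ w ω := by
  classical
  set I : Finset (Option ℕ) := {none} ∪ (Finset.range t).image some with hI
  let ext : Option ℕ → (I → EuclideanSpace ℝ (Fin m)) → EuclideanSpace ℝ (Fin m) :=
    fun k z => if h : k ∈ I then z ⟨k, h⟩ else 0
  have hext : ∀ k, Measurable (ext k) := fun k => by
    by_cases h : k ∈ I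
    · simpa [ext, h] using measurable_pi_apply (⟨k, h⟩ : I)
    · simp [ext, h]
  -- `φ` is the same recursion run on the coordinate space, with coordinates outside `I` set to
  -- zero; they do not affect the state or cost up to time `t`.
  refine ⟨stateCost A B Q R K (ext none) (fun s => ext (some s)) t,
    measurable_stateCost A B Q R K (hext _) (fun s => hext _) t, fun Ω x₀ w ω => ?_⟩
  refine stateCost_congr A B Q R K ?_ fun s hs => ?_
  · have h : none ∈ I := by simp [hI]
    simp [ext, h]
  · have h : some s ∈ I := by simp [hI, hs]
    simp [ext, h]

variable [MeasurableSpace Ω] {μ : Measure Ω} {X₀ W : Matrix (Fin m) (Fin m) ℝ}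
  {x₀ : Ω → EuclideanSpace ℝ (Fin m)} {w : ℕ → Ω → EuclideanSpace ℝ (Fin m)}

lemma IsGaussianNoise.aemeasurable (h : IsGaussianNoise μ X₀ W x₀ w) (k : Option ℕ) :
    AEMeasurable (k.elim x₀ w) μ := by
  cases k with
  | none => exact h.law_init.aemeasurable
  | some t => exact (h.law_noise t).aemeasurable

lemma IsGaussianNoise.aemeasurable_stateCost (h : IsGaussianNoise μ X₀ W x₀ w) (t : ℕ) :
    AEMeasurable (stateCost A B Q R K x₀ w t) μ := by
  obtain ⟨φ, hφ, hφe⟩ := exists_measurable_stateCost A B Q R K t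
  rw [funext (hφe Ω x₀ w)]
  exact hφ.comp_aemeasurable (aemeasurable_pi_lambda _ fun k => h.aemeasurable k)

/-- The pair depends only on `x₀` and `w_s` with `s < t`, a block of the independent family disjoint
from `w_t`. -/
lemma IsGaussianNoise.indepFun_stateCost (h : IsGaussianNoise μ X₀ W x₀ w) (t : ℕ) :
    IndepFun (stateCost A B Q R K x₀ w t) (w t) μ := by
  obtain ⟨φ, hφ, hφe⟩ := exists_measurable_stateCost A B Q R K t
  rw [funext (hφe Ω x₀ w)]
  have hi := h.indep.indepFun_finset₀ ({none} ∪ (Finset.range t).image some) {some t}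
    (by simp) h.aemeasurable
  have hm : Measurable fun z : ({some t} : Finset (Option ℕ)) → EuclideanSpace ℝ (Fin m) =>
    z ⟨some t, by simp⟩ := measurable_pi_apply _
  exact hi.comp hφ hm

end Dynamics

end LEQG

/-! ### Backward recursion for the expected cost, and the limit. -/

namespace LEQG

variable {m d : ℕ} {Ω : Type*}

lemma dotProduct_congr_mulVec (F S : Matrix (Fin m) (Fin m) ℝ) (x : Fin m → ℝ) :
    (F *ᵥ x) ⬝ᵥ S *ᵥ (F *ᵥ x) = x ⬝ᵥ (Fᵀ * S * F) *ᵥ x := by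
  rw [← Matrix.mulVec_mulVec, ← Matrix.mulVec_mulVec, Matrix.dotProduct_mulVec x,
    Matrix.vecMul_transpose]

/-- The factor contributed to the expected exponential cost by noise of covariance `W` in front of
the value matrix `S`. -/
noncomputable def noiseFactor (β : ℝ) (S W : Matrix (Fin m) (Fin m) ℝ) : ℝ :=
  (√(1 - β • (S * W)).det)⁻¹

section Recursion

variable (A : Matrix (Fin m) (Fin m) ℝ) (B : Matrix (Fin m) (Fin d) ℝ)
  (Q : Matrix (Fin m) (Fin m) ℝ) (R : Matrix (Fin d) (Fin d) ℝ) (K : Matrix (Fin d) (Fin m) ℝ)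
  [MeasurableSpace Ω] {μ : Measure Ω}
  {X₀ W : Matrix (Fin m) (Fin m) ℝ} {β : ℝ}
  {x₀ : Ω → EuclideanSpace ℝ (Fin m)} {w : ℕ → Ω → EuclideanSpace ℝ (Fin m)}

/-- The exponentiated cost before time `t` with the quadratic terminal cost `xᵀ S x` at time `t`. -/
noncomputable def terminalExpCost (β : ℝ) (x₀ : Ω → EuclideanSpace ℝ (Fin m))
    (w : ℕ → Ω → EuclideanSpace ℝ (Fin m)) (S : Matrix (Fin m) (Fin m) ℝ) (t : ℕ) (ω : Ω) : ℝ :=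
  Real.exp (β / 2 * (cumCost A B Q R K x₀ w t ω +
    (state A B K x₀ w t ω).ofLp ⬝ᵥ S *ᵥ (state A B K x₀ w t ω).ofLp))

/-- Integrating out the last noise variable. -/
lemma lintegral_terminalExpCost_succ [IsProbabilityMeasure μ] (h : IsGaussianNoise μ X₀ W x₀ w)
    {S : Matrix (Fin m) (Fin m) ℝ} (hW : W.PosDef) (hS : S.PosSemidef)
    (hWS : (W⁻¹ - β • S).PosDef) (t : ℕ) :
    ∫⁻ ω, ENNReal.ofReal (terminalExpCost A B Q R K β x₀ w S (t + 1) ω) ∂μ =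
      ENNReal.ofReal (noiseFactor β S W) *
        ∫⁻ ω, ENNReal.ofReal (terminalExpCost A B Q R K β x₀ w
          (Q + Kᵀ * R * K + (A - B * K)ᵀ * riskAdjust W β S * (A - B * K)) t ω) ∂μ := by
  set F := A - B * K with hF
  let drift : EuclideanSpace ℝ (Fin m) → EuclideanSpace ℝ (Fin m) :=
    fun x => WithLp.toLp 2 (F *ᵥ x.ofLp)
  let g : (EuclideanSpace ℝ (Fin m) × ℝ) × EuclideanSpace ℝ (Fin m) → ENNReal := fun p =>
    ENNReal.ofReal (Real.exp (β / 2 * p.1.2)) *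
      ENNReal.ofReal (Real.exp (β / 2 * ((drift p.1.1 + p.2).ofLp ⬝ᵥ
        S *ᵥ (drift p.1.1 + p.2).ofLp)))
  have hg : Measurable g := by
    have h₁ : Continuous fun p : (EuclideanSpace ℝ (Fin m) × ℝ) × EuclideanSpace ℝ (Fin m) =>
      Real.exp (β / 2 * p.1.2) := by fun_prop
    have h₂ : Continuous fun p : (EuclideanSpace ℝ (Fin m) × ℝ) × EuclideanSpace ℝ (Fin m) =>
      Real.exp (β / 2 * ((drift p.1.1 + p.2).ofLp ⬝ᵥ S *ᵥ (drift p.1.1 + p.2).ofLp)) := by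
      fun_prop
    exact h₁.measurable.ennreal_ofReal.mul h₂.measurable.ennreal_ofReal
  have hΦ := h.aemeasurable_stateCost A B Q R K t
  have hw := (h.law_noise t).aemeasurable
  -- Independence makes the joint law a product, so Tonelli allows `w_t` to be integrated first with
  -- the state frozen. Working with `lintegral` requires no prior integrability.
  have hmap := (indepFun_iff_map_prod_eq_prod_map_map hΦ hw).1
    (h.indepFun_stateCost A B Q R K t)
  have hl : ∀ ω, ENNReal.ofReal (terminalExpCost A B Q R K β x₀ w S (t + 1) ω) =
      g (stateCost A B Q R K x₀ w t ω, w t ω) := fun ω => by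
    simp only [g, drift, stateCost, terminalExpCost]
    rw [← ENNReal.ofReal_mul (by positivity), ← Real.exp_add, ← mul_add, state_succ, ← hF]
  simp_rw [hl]
  rw [← lintegral_map' (f := g) hg.aemeasurable (hΦ.prodMk hw), hmap, (h.law_noise t).map_eq,
    lintegral_prod _ hg.aemeasurable, lintegral_map' hg.lintegral_prod_right'.aemeasurable hΦ,
    ← lintegral_const_mul' _ _ ENNReal.ofReal_ne_top]
  refine lintegral_congr fun ω => ?_
  simp only [g]
  rw [lintegral_const_mul' _ _ ENNReal.ofReal_ne_top,
    lintegral_exp_quadratic_multivariateGaussian hW hS hWS, mul_left_comm, noiseFactor]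
  congr 1
  simp only [drift, stateCost, terminalExpCost]
  rw [← ENNReal.ofReal_mul (by positivity), ← Real.exp_add, dotProduct_congr_mulVec, cumCost,
    Finset.sum_range_succ, stageCost_feedback, Matrix.add_mulVec (Q + _), dotProduct_add, cumCost]
  congr 2
  ring

lemma lintegral_terminalExpCost_zero (h : IsGaussianNoise μ X₀ W x₀ w)
    {S : Matrix (Fin m) (Fin m) ℝ} (hX₀ : X₀.PosDef) (hS : S.PosSemidef)
    (hXS : (X₀⁻¹ - β • S).PosDef) :
    ∫⁻ ω, ENNReal.ofReal (terminalExpCost A B Q R K β x₀ w S 0 ω) ∂μ =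
      ENNReal.ofReal (noiseFactor β S X₀) := by
  have hg : Continuous fun x : EuclideanSpace ℝ (Fin m) =>
    Real.exp (β / 2 * ((0 + x).ofLp ⬝ᵥ S *ᵥ (0 + x).ofLp)) := by fun_prop
  have := lintegral_exp_quadratic_multivariateGaussian hX₀ hS hXS 0
  rw [← h.law_init.lintegral_comp hg.measurable.ennreal_ofReal.aemeasurable] at this
  simpa [terminalExpCost, cumCost, state, noiseFactor] using this

variable {P : Matrix (Fin m) (Fin m) ℝ}

/-- The statement is general in `n` because stepping back from time `t + 1` to `t` replaces iterate
`n` by `n + 1`; only `n = 0`, with zero terminal cost, is needed later. -/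
lemma lintegral_terminalExpCost_riccatiIter [IsProbabilityMeasure μ] (h : IsGaussianNoise μ X₀ W x₀ w)
    (hL : (Q + Kᵀ * R * K).PosDef) (hX₀ : X₀.PosDef) (hW : W.PosDef) (hP : P.PosSemidef)
    (hfix : P = Q + Kᵀ * R * K + (A - B * K)ᵀ * riskAdjust W β P * (A - B * K))
    (hWP : (W⁻¹ - β • P).PosDef) (hX₀P : (X₀⁻¹ - β • P).PosDef) (t : ℕ) : ∀ n : ℕ,
    ∫⁻ ω, ENNReal.ofReal (terminalExpCost A B Q R K β x₀ w
      (riccatiIter (Q + Kᵀ * R * K) (A - B * K) W β n) t ω) ∂μ =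
      ENNReal.ofReal ((∏ k ∈ Finset.range t,
        noiseFactor β (riccatiIter (Q + Kᵀ * R * K) (A - B * K) W β (n + k)) W) *
        noiseFactor β (riccatiIter (Q + Kᵀ * R * K) (A - B * K) W β (n + t)) X₀) := by
  induction t with
  | zero =>
    intro n
    rw [lintegral_terminalExpCost_zero A B Q R K h hX₀ (riccatiIter_bounds hL hW hP hfix hWP n).1
      (posDef_sub_riccatiIter hL hW hP hfix hWP hX₀.inv hX₀P n)]
    simp
  | succ t ih =>
    intro n
    rw [lintegral_terminalExpCost_succ A B Q R K h hW (riccatiIter_bounds hL hW hP hfix hWP n).1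
      (posDef_sub_riccatiIter hL hW hP hfix hWP hW.inv hWP n)]
    have := ih (n + 1)
    rw [riccatiIter] at this
    rw [this, ← ENNReal.ofReal_mul (by unfold noiseFactor; positivity), Finset.prod_range_succ']
    congr 1
    simp only [add_zero, ← add_assoc, add_right_comm n 1]
    ring

/-- The expected exponential cost over a finite horizon. -/
lemma integrable_expCost_and_integral_eq [IsProbabilityMeasure μ] (h : IsGaussianNoise μ X₀ W x₀ w)
    (hL : (Q + Kᵀ * R * K).PosDef) (hX₀ : X₀.PosDef) (hW : W.PosDef) (hP : P.PosSemidef)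
    (hfix : P = Q + Kᵀ * R * K + (A - B * K)ᵀ * riskAdjust W β P * (A - B * K))
    (hWP : (W⁻¹ - β • P).PosDef) (hX₀P : (X₀⁻¹ - β • P).PosDef) (T : ℕ) :
    Integrable (expCost A B Q R β K x₀ w T) μ ∧
    ∫ ω, expCost A B Q R β K x₀ w T ω ∂μ =
      (∏ k ∈ Finset.range T,
        noiseFactor β (riccatiIter (Q + Kᵀ * R * K) (A - B * K) W β k) W) *
        noiseFactor β (riccatiIter (Q + Kᵀ * R * K) (A - B * K) W β T) X₀ := by
  have hl := lintegral_terminalExpCost_riccatiIter A B Q R K h hL hX₀ hW hP hfix hWP hX₀P T 0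
  have he : terminalExpCost A B Q R K β x₀ w (riccatiIter (Q + Kᵀ * R * K) (A - B * K) W β 0) T
      = expCost A B Q R β K x₀ w T := by
    funext ω
    simp [terminalExpCost, riccatiIter, expCost, cumCost]
  rw [he] at hl
  simp only [zero_add] at hl
  have hpos : 0 ≤ᵐ[μ] expCost A B Q R β K x₀ w T :=
    ae_of_all _ fun ω => (Real.exp_pos _).le
  have hm : AEStronglyMeasurable (expCost A B Q R β K x₀ w T) μ := by
    have hc : AEMeasurable (cumCost A B Q R K x₀ w T) μ := by
      refine Finset.aemeasurable_fun_sum _ fun s _ => ?_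
      exact (continuous_stageCost_feedback Q R K).measurable.comp_aemeasurable
        (measurable_fst.comp_aemeasurable (h.aemeasurable_stateCost A B Q R K s))
    exact (Real.measurable_exp.comp_aemeasurable (hc.const_mul (β / 2))).aestronglyMeasurable
  constructor
  · rw [← lintegral_ofReal_ne_top_iff_integrable hm hpos, hl]
    exact ENNReal.ofReal_ne_top
  · rw [integral_eq_lintegral_of_nonneg_ae hpos hm, hl, ENNReal.toReal_ofReal]
    unfold noiseFactor
    positivity

end Recursion

lemma det_one_sub_pos {S W : Matrix (Fin m) (Fin m) ℝ} {β : ℝ} (hW : W.PosDef)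
    (hS : (W⁻¹ - β • S).PosDef) : 0 < (1 - β • (S * W)).det := by
  have : 1 - β • (S * W) = (W⁻¹ - β • S) * W := by
    rw [sub_mul, inv_mul_of_posDef hW, Matrix.smul_mul]
  rw [this, Matrix.det_mul]
  exact mul_pos hS.det_pos hW.det_pos

lemma noiseFactor_pos {S W : Matrix (Fin m) (Fin m) ℝ} {β : ℝ} (hW : W.PosDef)
    (hS : (W⁻¹ - β • S).PosDef) : 0 < noiseFactor β S W :=
  inv_pos.2 (Real.sqrt_pos.2 (det_one_sub_pos hW hS))

lemma log_noiseFactor {S W : Matrix (Fin m) (Fin m) ℝ} {β : ℝ} (hW : W.PosDef)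
    (hS : (W⁻¹ - β • S).PosDef) :
    Real.log (noiseFactor β S W) = -(1 / 2) * Real.log (1 - β • (S * W)).det := by
  rw [noiseFactor, Real.log_inv, Real.log_sqrt (det_one_sub_pos hW hS).le]
  ring

lemma tendsto_log_noiseFactor {P W : Matrix (Fin m) (Fin m) ℝ} {β : ℝ}
    {S : ℕ → Matrix (Fin m) (Fin m) ℝ} (hW : W.PosDef) (hS : ∀ n, (W⁻¹ - β • S n).PosDef)
    (hP : (W⁻¹ - β • P).PosDef) (h : Tendsto S atTop (𝓝 P)) :
    Tendsto (fun n => Real.log (noiseFactor β (S n) W)) atTop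
      (𝓝 (-(1 / 2) * Real.log (1 - β • (P * W)).det)) := by
  simp_rw [log_noiseFactor hW (hS _)]
  have hc : Continuous fun M : Matrix (Fin m) (Fin m) ℝ => (1 - β • (M * W)).det := by fun_prop
  exact (((hc.tendsto P).comp h).log (det_one_sub_pos hW hP).ne').const_mul _

/-- The Riccati equation as a fixed-point equation for the risk-adjusted iteration. -/
lemma Riccati.eq_fixedPoint {A : Matrix (Fin m) (Fin m) ℝ} {B : Matrix (Fin m) (Fin d) ℝ}
    {Q : Matrix (Fin m) (Fin m) ℝ} {R : Matrix (Fin d) (Fin d) ℝ} {W : Matrix (Fin m) (Fin m) ℝ}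
    {β : ℝ} {K : Matrix (Fin d) (Fin m) ℝ} {P : Matrix (Fin m) (Fin m) ℝ}
    (h : Riccati A B Q R W β K P) (hβ : β ≠ 0)
    (hWP : (W⁻¹ - β • P).PosDef) :
    P = Q + Kᵀ * R * K + (A - B * K)ᵀ * riskAdjust W β P * (A - B * K) := by
  have e : (-1 / β) • W⁻¹ + P = (-1 / β) • (W⁻¹ - β • P) := by
    rw [smul_sub, smul_smul, div_mul_cancel₀ _ hβ]
    simp
  have e' : ((-1 / β) • (W⁻¹ - β • P))⁻¹ = (-β) • (W⁻¹ - β • P)⁻¹ := by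
    refine Matrix.inv_eq_right_inv ?_
    rw [Matrix.smul_mul, Matrix.mul_smul, smul_smul, mul_inv_of_posDef hWP,
      show -1 / β * -β = 1 by field_simp, one_smul]
  rw [Riccati, e, e'] at h
  rw [riskAdjust]
  simpa [sub_eq_add_neg] using h

end LEQG

theorem lemma2p1 {m d : ℕ}
    (A : Matrix (Fin m) (Fin m) ℝ) (B : Matrix (Fin m) (Fin d) ℝ)
    (Q : Matrix (Fin m) (Fin m) ℝ) (R : Matrix (Fin d) (Fin d) ℝ)
    (X₀ W : Matrix (Fin m) (Fin m) ℝ) (β : ℝ)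
    (hQ : Q.PosDef) (hR : R.PosDef) (hX₀ : X₀.PosDef) (hW : W.PosDef) (hβ : β ≠ 0)
    {Ω : Type*} [MeasurableSpace Ω] (μ : Measure Ω) [IsProbabilityMeasure μ]
    (x₀ : Ω → EuclideanSpace ℝ (Fin m)) (w : ℕ → Ω → EuclideanSpace ℝ (Fin m))
    (hnoise : LEQG.IsGaussianNoise μ X₀ W x₀ w)
    (K : Matrix (Fin d) (Fin m) ℝ) (P : Matrix (Fin m) (Fin m) ℝ)
    (hP : P.PosSemidef) (hric : LEQG.Riccati A B Q R W β K P)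
    (hstab : LEQG.SpectrallyStable ((A - B * K)ᵀ * (1 - β • (P * W))⁻¹))
    (hWP : (W⁻¹ - β • P).PosDef)
    (hX₀P : (X₀⁻¹ - β • P).PosDef) :
    LEQG.HasAverageCost μ A B Q R β K x₀ w
      (-(1 / β) * Real.log (1 - β • (P * W)).det) := by
  have hL : (Q + Kᵀ * R * K).PosDef :=
    hQ.add_posSemidef (LEQG.posSemidef_transpose_mul_mul_same hR.posSemidef K)
  have hfix := hric.eq_fixedPoint hβ hWP
  have hstab' : LEQG.SpectrallyStable ((A - B * K)ᵀ * W⁻¹ * (W⁻¹ - β • P)⁻¹) := by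
    have e : 1 - β • (P * W) = (W⁻¹ - β • P) * W := by
      rw [sub_mul, LEQG.inv_mul_of_posDef hW, Matrix.smul_mul]
    rwa [e, Matrix.mul_inv_rev, ← mul_assoc] at hstab
  have hlim := LEQG.tendsto_riccatiIter hL hW hP hfix hWP hstab'
  have hSW := LEQG.posDef_sub_riccatiIter hL hW hP hfix hWP hW.inv hWP
  have hSX := LEQG.posDef_sub_riccatiIter hL hW hP hfix hWP hX₀.inv hX₀P
  have hE := LEQG.integrable_expCost_and_integral_eq A B Q R K hnoise hL hX₀ hW hP hfix hWP hX₀P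
  set S := LEQG.riccatiIter (Q + Kᵀ * R * K) (A - B * K) W β
  refine ⟨fun T => (hE T).1, ?_⟩
  have hlog : ∀ T : ℕ, Real.log (∫ ω, LEQG.expCost A B Q R β K x₀ w T ω ∂μ) =
      (∑ k ∈ Finset.range T, Real.log (LEQG.noiseFactor β (S k) W)) +
        Real.log (LEQG.noiseFactor β (S T) X₀) := fun T => by
    rw [(hE T).2, Real.log_mul (Finset.prod_ne_zero_iff.2 fun k _ =>
        (LEQG.noiseFactor_pos hW (hSW k)).ne') (LEQG.noiseFactor_pos hX₀ (hSX T)).ne',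
      Real.log_prod fun k _ => (LEQG.noiseFactor_pos hW (hSW k)).ne']
  -- Cesàro means inherit the limit `-(1/2) log det(1 - βPW)`; the factor `2/β` turns it into the
  -- claimed value.
  have h₁ := (LEQG.tendsto_log_noiseFactor hW hSW hWP hlim).cesaro
  -- The `X₀` term converges, hence vanishes after multiplication by `1/T`.
  have h₂ := tendsto_inv_atTop_nhds_zero_nat (𝕜 := ℝ).mul
    (LEQG.tendsto_log_noiseFactor hX₀ hSX hX₀P hlim)
  have h₃ := (h₁.add h₂).const_mul (2 / β)
  refine (h₃.congr fun T => ?_).trans_eq ?_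
  · rw [hlog]; ring
  · ring_nf
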